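/- Let $n\ge 1$, let $V$ be a complex vector space with basis $x_1,\dots,x_n$, and let $S_{-1}(V)$ be the $\mathbb C$-algebra generated by $x_1,\dots,x_n$ subject to the relations $x_ix_j=-x_jx_i$ for $i\ne j$. The group $\mathbb G_n=(\mathbb C^\times)^n\rtimes\mathbb S_n\subset \mathrm{GL}(V)$ of monomial matrices (diagonal matrices $t$ times permutation matrices $w$) acts on $S_{-1}(V)$ by the algebra automorphisms that extend its natural linear action on $V$. Let $\mathcal C'\subseteq\mathcal C$ be finite subgroups of $\mathbb C^\times$, where $|\mathcal C|$ is even, and put $$W_{\mathcal C,\mathcal C'}=\{tw : t\in\mathcal C^n,\ w\in\mathbb S_n,\ \det(tw)\in\mathcal C'\}\subset\mathbb G_n .$$ In $S_{-1}(V)$ consider the elements $$p_k^{(|\mathcal C|)}=\sum_{i=1}^n x_i^{k|\mathcal C|}\quad(1\le k\le n-1),\qquad r^{(|\mathcal C'|)}=x_1^{|\mathcal C'|}x_2^{|\mathcal C'|}\cdots x_n^{|\mathcal C'|}.$$ Then: (a) the elements $p_1^{(|\mathcal C|)},\dots,p_{n-1}^{(|\mathcal C|)},r^{(|\mathcal C'|)}$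 commute pairwise and are invariant under $W_{\mathcal C,\mathcal C'}$; (b) the subalgebra of invariants $S_{-1}(V)^{W_{\mathcal C,\mathcal C'}}$ equals the unital $\mathbb C$-subalgebra of $S_{-1}(V)$ generated by $p_1^{(|\mathcal C|)},\dots,p_{n-1}^{(|\mathcal C|)},r^{(|\mathcal C'|)}$. -/

import Mathlib

/-! ### Skew-polynomial algebras -/

/-- The defining relations `x_i x_j = q_ij x_j x_i` on the free algebra generated by
`x_1, …, x_n`. -/
inductive SkewPolyRel {n : ℕ} (q : Fin n → Fin n → ℂ) :
    FreeAlgebra ℂ (Fin n) → FreeAlgebra ℂ (Fin n) → Prop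
  | swap (i j : Fin n) :
      SkewPolyRel q (FreeAlgebra.ι ℂ i * FreeAlgebra.ι ℂ j)
        (q i j • (FreeAlgebra.ι ℂ j * FreeAlgebra.ι ℂ i))

/-- The algebra `S_q(V)` generated by a space `V` with basis `x_1, …, x_n` subject to the
relations `x_i x_j = q_ij x_j x_i`. -/
abbrev SkewPoly {n : ℕ} (q : Fin n → Fin n → ℂ) : Type :=
  RingQuot (SkewPolyRel q)

/-- The matrix with `q_ii = 1` and `q_ij = -1` for `i ≠ j`. -/
def minusOne (n : ℕ) (i j : Fin n) : ℂ := if i = j then 1 else -1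

/-- The skew-polynomial algebra `S_{-1}(V)`, `dim V = n`. -/
def SMinusOne (n : ℕ) : Type := SkewPoly (minusOne n)

noncomputable section

instance (n : ℕ) : Ring (SMinusOne n) := inferInstanceAs (Ring (SkewPoly (minusOne n)))

instance (n : ℕ) : Algebra ℂ (SMinusOne n) :=
  inferInstanceAs (Algebra ℂ (SkewPoly (minusOne n)))

namespace SMinusOne

/-- The generator `x_i` of `S_{-1}(V)`. -/
def x {n : ℕ} (i : Fin n) : SMinusOne n :=
  RingQuot.mkAlgHom ℂ (SkewPolyRel (minusOne n)) (FreeAlgebra.ι ℂ i)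

theorem x_mul_x {n : ℕ} (i j : Fin n) :
    (x i * x j : SMinusOne n) = minusOne n i j • (x j * x i) := by
  have h := RingQuot.mkAlgHom_rel ℂ (SkewPolyRel.swap (q := minusOne n) i j)
  rw [map_mul, map_smul, map_mul] at h
  exact h

/-- The universal property of `S_{-1}(V)`. -/
def lift {n : ℕ} {A : Type*} [Ring A] [Algebra ℂ A] (y : Fin n → A)
    (hy : ∀ i j, y i * y j = minusOne n i j • (y j * y i)) : SMinusOne n →ₐ[ℂ] A :=
  RingQuot.liftAlgHom ℂ ⟨FreeAlgebra.lift ℂ y, by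
    rintro _ _ ⟨i, j⟩
    simpa using hy i j⟩

@[simp] theorem lift_x {n : ℕ} {A : Type*} [Ring A] [Algebra ℂ A] (y : Fin n → A)
    (hy : ∀ i j, y i * y j = minusOne n i j • (y j * y i)) (i : Fin n) :
    lift y hy (x i) = y i := by
  have h := RingQuot.liftAlgHom_mkAlgHom_apply (S := ℂ) (s := SkewPolyRel (minusOne n))
    (FreeAlgebra.lift ℂ y) (by rintro _ _ ⟨i, j⟩; simpa using hy i j) (FreeAlgebra.ι ℂ i)
  rw [FreeAlgebra.lift_ι_apply] at h
  exact h

theorem hom_ext {n : ℕ} {A : Type*} [Ring A] [Algebra ℂ A] {f g : SMinusOne n →ₐ[ℂ] A}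
    (h : ∀ i, f (x i) = g (x i)) : f = g := by
  refine RingQuot.ringQuot_ext' ℂ f g (FreeAlgebra.hom_ext (funext h))

theorem x_pow_mul {n : ℕ} {i j : Fin n} (h : i ≠ j) (a b : ℕ) :
    (x i ^ a * x j ^ b : SMinusOne n) = ((-1 : ℂ) ^ (a * b)) • (x j ^ b * x i ^ a) := by
  have h1 : (x i * x j : SMinusOne n) = (-1:ℂ) • (x j * x i) := by
    rw [x_mul_x]; simp [minusOne, h]
  have h2 : ∀ b, (x i * x j ^ b : SMinusOne n) = ((-1 : ℂ) ^ b) • (x j ^ b * x i) := by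
    intro b
    induction b with
    | zero => simp
    | succ b ih =>
      rw [pow_succ, ← mul_assoc, ih, smul_mul_assoc, mul_assoc, h1, mul_smul_comm, smul_smul,
        ← mul_assoc, pow_succ]
  induction a with
  | zero => simp
  | succ a ih =>
    rw [pow_succ, mul_assoc, h2, mul_smul_comm, ← mul_assoc, ih, smul_mul_assoc, smul_smul,
      mul_assoc, ← pow_add]
    congr 2; ring

/-- The basis element `x_1 ^ k_1 x_2 ^ k_2 ⋯ x_n ^ k_n` of the space `S(V)`, regarded as an element of
`S_{-1}(V)`: the factors are multiplied in increasing order of the index. -/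
def mono {n : ℕ} (k : Fin n → ℕ) : SMinusOne n :=
  (List.ofFn fun i => (x i : SMinusOne n) ^ k i).prod

end SMinusOne

/-! ### Monomial matrices -/

/-- The action of the symmetric group on the torus by permuting coordinates,
`(w t)_i = t_{w⁻¹ i}`. -/
def permTorus (n : ℕ) : Equiv.Perm (Fin n) →* MulAut (Fin n → ℂˣ) where
  toFun w :=
    { toFun := fun t i => t (w⁻¹ i)
      invFun := fun t i => t (w i)
      left_inv := fun t => by ext i; simp
      right_inv := fun t => by ext i; simp
      map_mul' := fun _ _ => rfl }
  map_one' := rfl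
  map_mul' _ _ := rfl

/-- The group `𝔾_n = (ℂˣ)ⁿ ⋊ 𝕊_n` of monomial matrices; the pair `(t, w)` is written `t w`. -/
abbrev MonomialGroup (n : ℕ) : Type := (Fin n → ℂˣ) ⋊[permTorus n] Equiv.Perm (Fin n)

namespace MonomialGroup

/-- The monomial matrix of `t w`: the product of the diagonal matrix `t` and of the permutation
matrix of `w`, so that `t w` maps the basis vector `x_j` to `t_{w j} x_{w j}`. -/
def toMatrix (n : ℕ) : MonomialGroup n →* Matrix (Fin n) (Fin n) ℂ where
  toFun g := Matrix.of fun i j => if i = g.right j then (g.left i : ℂ) else 0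
  map_one' := by
    ext i j
    by_cases h : i = j <;> simp [h, Matrix.one_apply]
  map_mul' g h := by
    ext i j
    simp only [Matrix.of_apply, Matrix.mul_apply, SemidirectProduct.mul_left,
      SemidirectProduct.mul_right, Pi.mul_apply, Equiv.Perm.mul_apply]
    rw [Finset.sum_eq_single (h.right j)]
    · by_cases hi : i = g.right (h.right j)
      · subst hi
        simp [permTorus]
      · simp [hi]
    · intro k _ hk
      simp [hk]
    · simp

/-- The inclusion of `𝔾_n` into `GL_n(ℂ)`. -/
def toGL (n : ℕ) : MonomialGroup n →* GL (Fin n) ℂ := (toMatrix n).toHomUnits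

/-- The restriction to `𝔾_n` of the determinant character of `GL_n(ℂ)`. -/
def det (n : ℕ) : MonomialGroup n →* ℂˣ := Matrix.GeneralLinearGroup.det.comp (toGL n)

/-- The algebra endomorphism of `S_{-1}(V)` that extends the linear map
`x_j ↦ t_{w j} x_{w j}` of `V`. -/
def act {n : ℕ} (g : MonomialGroup n) : SMinusOne n →ₐ[ℂ] SMinusOne n :=
  SMinusOne.lift (fun j => (g.left (g.right j) : ℂ) • SMinusOne.x (g.right j)) (by
    intro i j
    have h : minusOne n (g.right i) (g.right j) = minusOne n i j := by
      simp [minusOne]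
    rw [smul_mul_smul_comm, smul_mul_smul_comm, SMinusOne.x_mul_x (g.right i), h,
      smul_comm, mul_comm (g.left (g.right i) : ℂ)])

@[simp] theorem act_x {n : ℕ} (g : MonomialGroup n) (j : Fin n) :
    act g (SMinusOne.x j) = (g.left (g.right j) : ℂ) • SMinusOne.x (g.right j) := by
  simp [act]

/-- The action of `𝔾_n` on `S_{-1}(V)` by algebra automorphisms that extends the defining
action on `V`. -/
instance (n : ℕ) : MulSemiringAction (MonomialGroup n) (SMinusOne n) where
  smul g a := act g a
  one_smul a := by
    have h : act (1 : MonomialGroup n) = AlgHom.id ℂ _ := SMinusOne.hom_ext fun i => by simp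
    exact DFunLike.congr_fun h a
  mul_smul g h a := by
    have e : act (g * h) = (act g).comp (act h) := SMinusOne.hom_ext fun i => by
      simp [permTorus, smul_smul, mul_comm]
    exact DFunLike.congr_fun e a
  smul_zero g := map_zero (act g)
  smul_add g := map_add (act g)
  smul_one g := map_one (act g)
  smul_mul g := map_mul (act g)

theorem smul_def {n : ℕ} (g : MonomialGroup n) (a : SMinusOne n) : g • a = act g a := rfl

instance (n : ℕ) : SMulCommClass (MonomialGroup n) ℂ (SMinusOne n) where
  smul_comm g c a := map_smul (act g) c a

/-- On `V` the action is the defining one: `x_j ↦ ∑ i, g_ij x_i`. -/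
theorem smul_x {n : ℕ} (g : MonomialGroup n) (j : Fin n) :
    g • (SMinusOne.x j : SMinusOne n) =
      ∑ i, (toGL n g : Matrix (Fin n) (Fin n) ℂ) i j • SMinusOne.x i := by
  simp [smul_def, toGL, toMatrix, ite_smul]

open SMinusOne in
/-- The torus acts on monomials by `t ▷ x^k = ∏ j, t_j ^ k_j • x^k`. -/
theorem t_smul {n : ℕ} (t : Fin n → ℂˣ) (k : Fin n → ℕ) :
    (SemidirectProduct.inl t : MonomialGroup n) • mono k = (∏ j, (t j : ℂ) ^ k j) • mono k := by
  have : ∀ L : List (Fin n), act (SemidirectProduct.inl t : MonomialGroup n) (L.map fun i => (x i : SMinusOne n) ^ k i).prod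
     = (L.map fun j => (t j : ℂ) ^ k j).prod • (L.map fun i => (x i : SMinusOne n) ^ k i).prod := by
    intro L
    induction L with
    | nil => simp
    | cons a L ih => simp [ih, smul_pow, smul_smul, mul_comm]
  have h := this (List.finRange n)
  rw [← List.ofFn_eq_map, ← List.ofFn_eq_map, List.prod_ofFn] at h
  exact h

open SMinusOne in
/-- The transposition `s_i` acts on monomials by
`s_i ▷ x^k = (-1) ^ (k_i k_{i+1}) • x^(s_i k)`. -/
theorem s_smul {n : ℕ} (i : ℕ) (hi : i + 1 < n) (k : Fin n → ℕ) :
    (SemidirectProduct.inr (Equiv.swap ⟨i, by omega⟩ ⟨i+1, hi⟩) : MonomialGroup n) • mono k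
     = ((-1 : ℂ) ^ (k ⟨i, by omega⟩ * k ⟨i+1, hi⟩)) • mono (k ∘ Equiv.swap ⟨i, by omega⟩ ⟨i+1, hi⟩) := by
  set s := Equiv.swap (⟨i, by omega⟩ : Fin n) ⟨i+1, hi⟩ with hs
  have hL : List.finRange n = (List.finRange n).take i ++ (⟨i, by omega⟩ :: ⟨i+1, hi⟩ :: (List.finRange n).drop (i+2)) := by
    conv_lhs => rw [← List.take_append_drop i (List.finRange n)]
    rw [List.drop_eq_getElem_cons (by simp; omega), List.drop_eq_getElem_cons (by simp; omega)]
    simp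
  have key : ∀ L : List (Fin n), (∀ a ∈ L, s a = a) →
     act (SemidirectProduct.inr s : MonomialGroup n) (L.map fun i => (x i : SMinusOne n) ^ k i).prod
     = (L.map fun i => (x i : SMinusOne n) ^ (k ∘ s) i).prod := by
    intro L hL
    induction L with
    | nil => simp
    | cons a L ih => 
      have := hL a (by simp)
      simp [ih fun b hb => hL b (by simp [hb]), this]
  have k1 := key ((List.finRange n).take i) (by
    intro a ha
    rw [List.mem_take_iff_getElem] at ha
    obtain ⟨j, hj, rfl⟩ := ha
    apply Equiv.swap_apply_of_ne_of_ne <;> simp [Fin.ext_iff] <;> omega)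
  have k2 := key ((List.finRange n).drop (i+2)) (by
    intro a ha
    rw [List.mem_drop_iff_getElem] at ha
    obtain ⟨j, hj, rfl⟩ := ha
    apply Equiv.swap_apply_of_ne_of_ne <;> simp [Fin.ext_iff] <;> omega)
  have e1 : s ⟨i, by omega⟩ = ⟨i+1, hi⟩ := Equiv.swap_apply_left _ _
  have e2 : s ⟨i+1, hi⟩ = ⟨i, by omega⟩ := Equiv.swap_apply_right _ _
  rw [smul_def, mono, mono, List.ofFn_eq_map, List.ofFn_eq_map, hL]
  simp only [List.map_append, List.map_cons, List.prod_append, List.prod_cons, map_mul, k1, k2, map_pow, act_x, Function.comp]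
  simp only [SemidirectProduct.left_inr, SemidirectProduct.right_inr, Pi.one_apply, Units.val_one, one_smul, e1, e2]
  rw [← mul_assoc (x _ ^ _) (x _ ^ _), x_pow_mul (by simp [Fin.ext_iff])]
  simp [mul_assoc]

end MonomialGroup

/-- The group `W_{C,C'} = {t w ∈ Cⁿ ⋊ 𝕊_n : det (t w) ∈ C'}`. -/
def groupW (n : ℕ) (C C' : Subgroup ℂˣ) : Subgroup (MonomialGroup n) where
  carrier := {g | (∀ i, g.left i ∈ C) ∧ MonomialGroup.det n g ∈ C'}
  one_mem' := by
    refine ⟨fun i => ?_, ?_⟩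
    · simp
    · rw [map_one]
      exact C'.one_mem
  mul_mem' := by
    rintro g h ⟨hg, hg'⟩ ⟨hh, hh'⟩
    refine ⟨fun i => ?_, ?_⟩
    · exact C.mul_mem (hg i) (hh _)
    · rw [map_mul]
      exact C'.mul_mem hg' hh'
  inv_mem' := by
    rintro g ⟨hg, hg'⟩
    refine ⟨fun i => ?_, ?_⟩
    · exact C.inv_mem (hg _)
    · rw [map_inv]
      exact C'.inv_mem hg'

/-! ### The generating invariants -/

/-- `p_k^{(m)} = ∑ i, x_i ^ (k m)`. -/
def powerSum (n m k : ℕ) : SMinusOne n := ∑ i, SMinusOne.x i ^ (k * m)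

/-- `r^{(l)} = x_1 ^ l x_2 ^ l ⋯ x_n ^ l`. -/
def monomialR (n l : ℕ) : SMinusOne n := SMinusOne.mono fun _ => l

/-- The elements `p_1^{(m)}, …, p_{n-1}^{(m)}, r^{(l)}`. -/
def invariantGenerators (n m l : ℕ) : Set (SMinusOne n) :=
  {a | (∃ k : ℕ, 1 ≤ k ∧ k < n ∧ a = powerSum n m k) ∨ a = monomialR n l}

end

/-!
Write `m = |C|` and `l = |C'|`. The group `W = W_{C,C'}` is finite, so every invariant is the average
of its translates over `W`; since `S_{-1}(V)` is spanned by words in the generators, it suffices to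
show that the sum over `W` of the translates of a word lies in the subalgebra generated by
`p_1, …, p_{n-1}, r` (`sum_smul_word_mem_adjoin`). Only this spanning property is used, not the
linear independence of the ordered monomials.

Suppose that the diagonal part of `W` multiplies a word by a nontrivial character. Then the sum is
zero. Otherwise the elements `diag(…, ζ, …, ζ⁻¹, …)` with `ζ ∈ C` and `diag(…, ζ', …)` with `ζ' ∈ C'`
show that the exponents of the word are congruent to each other modulo `m` and divisible by `l`
(`count_modEq_of_forall_torus`). As rearranging a word changes it only by a scalar, the word is a
scalar multiple of `r ^ j * P(x_1 ^ m, …, x_n ^ m)`, with `P` a commutative monomial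
(`exists_word_eq_smul_monomialR_pow_mul`).

Because `m` is even, the `x_i ^ m` are central, so `P ↦ P(x_1 ^ m, …, x_n ^ m)` is an algebra
homomorphism `evalPow` from commutative polynomials, and `W` acts on its image through permutations
of the variables. The element `r` is invariant, because `g • r = det(g) ^ l • r`
(`MonomialGroup.smul_monomialR`); the sign of the permutation comes from the anticommutation of the
generators. Hence the sum over `W` is a multiple of `r ^ j` times the value of the polynomial `∑ g, w_g P`, which is
symmetric: since `-1 ∈ C`, every permutation is the permutation part of an element of `W`
(`exists_mem_groupW_right_eq`). By Newton's identities a symmetric polynomial is a polynomial in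
the power sums of degree less than `n` and in `X_1 ⋯ X_n`, and the value of `X_1 ⋯ X_n` at the
`x_i ^ m` is a scalar multiple of `r ^ (m / l)`.
-/

namespace SMinusOne

variable {n : ℕ}

/-! ### Words in the generators -/

/-- The word `x_{i_1} x_{i_2} ⋯ x_{i_d}` attached to a list of indices. -/
noncomputable def word (L : List (Fin n)) : SMinusOne n := (L.map x).prod

@[simp] theorem word_nil : word ([] : List (Fin n)) = 1 := rfl

@[simp] theorem word_cons (i : Fin n) (L : List (Fin n)) : word (i :: L) = x i * word L := by
  simp [word]

@[simp] theorem word_append (L L' : List (Fin n)) : word (L ++ L') = word L * word L' := by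
  simp [word]

theorem adjoin_range_x : Algebra.adjoin ℂ (Set.range (x : Fin n → SMinusOne n)) = ⊤ := by
  have h := congrArg (Subalgebra.map (RingQuot.mkAlgHom ℂ (SkewPolyRel (minusOne n))))
    (FreeAlgebra.adjoin_range_ι ℂ (Fin n))
  rw [AlgHom.map_adjoin, ← Set.range_comp, Algebra.map_top,
    (AlgHom.range_eq_top _).2 (RingQuot.mkAlgHom_surjective ℂ _)] at h
  exact h

theorem span_range_word : Submodule.span ℂ (Set.range (word (n := n))) = ⊤ := by
  rw [← Algebra.top_toSubmodule, ← adjoin_range_x, Algebra.adjoin_eq_span]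
  apply le_antisymm
  · apply Submodule.span_mono
    rintro _ ⟨L, rfl⟩
    refine Submonoid.list_prod_mem _ fun a ha => Submonoid.subset_closure ?_
    obtain ⟨i, -, rfl⟩ := List.mem_map.1 ha
    exact ⟨i, rfl⟩
  · apply Submodule.span_mono
    intro a ha
    induction ha using Submonoid.closure_induction with
    | mem a ha =>
      obtain ⟨i, rfl⟩ := ha
      exact ⟨[i], by simp⟩
    | one => exact ⟨[], rfl⟩
    | mul a b _ _ ha hb =>
      obtain ⟨L, rfl⟩ := ha
      obtain ⟨L', rfl⟩ := hb
      exact ⟨L ++ L', by simp⟩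

/-- Rearranging a word changes it by a scalar only. -/
theorem exists_word_eq_smul_of_perm {L L' : List (Fin n)} (h : L.Perm L') :
    ∃ ε : ℂ, word L = ε • word L' := by
  induction h with
  | nil => exact ⟨1, by simp⟩
  | cons i _ ih =>
    obtain ⟨ε, hε⟩ := ih
    exact ⟨ε, by simp [hε]⟩
  | swap i j L =>
    refine ⟨minusOne n j i, ?_⟩
    rw [word_cons, word_cons, word_cons, word_cons, ← mul_assoc, x_mul_x, smul_mul_assoc,
      mul_assoc]
  | trans _ _ ih ih' =>
    obtain ⟨ε, hε⟩ := ih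
    obtain ⟨δ, hδ⟩ := ih'
    exact ⟨ε * δ, by rw [hε, hδ, smul_smul]⟩

/-- The list in which the index `i` occurs `k i` times, in increasing order. -/
def exponentList (k : Fin n → ℕ) : List (Fin n) :=
  (List.finRange n).flatMap fun i => List.replicate (k i) i

theorem count_exponentList (k : Fin n → ℕ) (i : Fin n) : (exponentList k).count i = k i := by
  rw [exponentList, List.count_flatMap]
  have h : (List.count i ∘ fun j => List.replicate (k j) j) = fun j => if j = i then k j else 0 := by
    funext j
    simp [List.count_replicate]
  rw [h, ← List.ofFn_eq_map, List.sum_ofFn]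
  simp

theorem word_flatMap_replicate (k : Fin n → ℕ) (L : List (Fin n)) :
    word (L.flatMap fun i => List.replicate (k i) i) = (L.map fun i => x i ^ k i).prod := by
  induction L with
  | nil => simp
  | cons a L ih =>
    rw [List.flatMap_cons, word_append, ih, List.map_cons, List.prod_cons]
    simp [word]

theorem word_exponentList (k : Fin n → ℕ) : word (exponentList k) = mono k := by
  rw [exponentList, word_flatMap_replicate, mono, List.ofFn_eq_map]

theorem exists_word_eq_smul_mono (L : List (Fin n)) :
    ∃ ε : ℂ, word L = ε • mono fun i => L.count i := by
  simp_rw [← word_exponentList]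
  exact exists_word_eq_smul_of_perm (List.perm_iff_count.2 fun i => by rw [count_exponentList])

theorem exists_mono_add_eq_smul (k k' : Fin n → ℕ) :
    ∃ ε : ℂ, (mono (k + k') : SMinusOne n) = ε • (mono k * mono k') := by
  simp_rw [← word_exponentList, ← word_append]
  exact exists_word_eq_smul_of_perm (List.perm_iff_count.2 fun i => by
    simp [count_exponentList, List.count_append])

theorem exists_mono_const_mul_eq_smul (l j : ℕ) :
    ∃ ε : ℂ, (mono fun _ => l * j : SMinusOne n) = ε • (monomialR n l) ^ j := by
  induction j with
  | zero => exact ⟨1, by simp [mono]⟩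
  | succ j ih =>
    obtain ⟨ε, hε⟩ := ih
    obtain ⟨δ, hδ⟩ := exists_mono_add_eq_smul (n := n) (fun _ => l * j) (fun _ => l)
    refine ⟨δ * ε, ?_⟩
    have h : (fun _ : Fin n => l * (j + 1)) = (fun _ => l * j) + fun _ => l := by
      funext i; simp [mul_add]
    rw [h, hδ, hε, smul_mul_assoc, smul_smul, pow_succ, monomialR]

/-! ### The central subalgebra of polynomials in the even powers `x_i ^ m` -/

theorem commute_x_pow {m : ℕ} (hm : Even m) (i : Fin n) (a : SMinusOne n) :
    Commute (x i ^ m) a := by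
  have ha : a ∈ Algebra.adjoin ℂ (Set.range (x : Fin n → SMinusOne n)) := by
    rw [adjoin_range_x]; trivial
  induction ha using Algebra.adjoin_induction with
  | mem a ha =>
    obtain ⟨j, rfl⟩ := ha
    by_cases h : i = j
    · subst h
      exact (Commute.refl _).pow_left m
    · have := x_pow_mul h m 1
      rw [pow_one, mul_one, hm.neg_one_pow, one_smul] at this
      exact this
  | algebraMap c => exact (Algebra.commutes c _).symm
  | add a b _ _ ha hb => exact ha.add_right hb
  | mul a b _ _ ha hb => exact ha.mul_right hb

/-- For even `m`, the evaluation `P ↦ P(x_1 ^ m, …, x_n ^ m)` of a commutative polynomial at the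
central elements `x_i ^ m`. -/
noncomputable def evalPow {m : ℕ} (hm : Even m) : MvPolynomial (Fin n) ℂ →ₐ[ℂ] SMinusOne n :=
  (Subalgebra.center ℂ (SMinusOne n)).val.comp (MvPolynomial.aeval fun i =>
    ⟨x i ^ m, Subalgebra.mem_center_iff.2 fun b => (commute_x_pow hm i b).eq.symm⟩)

@[simp] theorem evalPow_X {m : ℕ} (hm : Even m) (i : Fin n) :
    evalPow hm (MvPolynomial.X i) = x i ^ m := by
  simp [evalPow]

theorem commute_evalPow {m : ℕ} (hm : Even m) (P : MvPolynomial (Fin n) ℂ) (a : SMinusOne n) :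
    Commute (evalPow hm P) a :=
  (Subalgebra.mem_center_iff.1 (Subtype.prop (MvPolynomial.aeval _ P)) a).symm

theorem evalPow_psum {m : ℕ} (hm : Even m) (k : ℕ) :
    evalPow hm (MvPolynomial.psum (Fin n) ℂ k) = powerSum n m k := by
  simp [MvPolynomial.psum, powerSum, ← pow_mul, mul_comm]

theorem evalPow_prod_X_pow {m : ℕ} (hm : Even m) (a : Fin n → ℕ) :
    evalPow hm ((List.finRange n).map fun i => MvPolynomial.X i ^ a i).prod =
      mono fun i => m * a i := by
  rw [map_list_prod, List.map_map, mono, List.ofFn_eq_map]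
  congr 2
  funext i
  simp [pow_mul]

/-! ### Symmetric polynomials -/

/-- Over `ℂ` the symmetric polynomials are generated by `psum 1, …, psum (n - 1)` and
`esymm n = X_1 ⋯ X_n`: Newton's identities express `esymm k`, `k < n`, through power sums. -/
theorem _root_.MvPolynomial.IsSymmetric.mem_adjoin_psum {P : MvPolynomial (Fin n) ℂ}
    (hP : P.IsSymmetric) :
    P ∈ Algebra.adjoin ℂ (insert (MvPolynomial.esymm (Fin n) ℂ n)
      {q | ∃ k : ℕ, 1 ≤ k ∧ k < n ∧ q = MvPolynomial.psum (Fin n) ℂ k}) := by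
  set S := Algebra.adjoin ℂ (insert (MvPolynomial.esymm (Fin n) ℂ n)
      {q | ∃ k : ℕ, 1 ≤ k ∧ k < n ∧ q = MvPolynomial.psum (Fin n) ℂ k})
  have hlt : ∀ k, k < n → MvPolynomial.esymm (Fin n) ℂ k ∈ S := by
    intro k
    induction k using Nat.strong_induction_on with
    | _ k ih =>
      intro hk
      rcases Nat.eq_zero_or_pos k with rfl | hk0
      · rw [MvPolynomial.esymm_zero]
        exact S.one_mem
      · have hN := MvPolynomial.mul_esymm_eq_sum (Fin n) ℂ k
        have hmem : (k : MvPolynomial (Fin n) ℂ) * MvPolynomial.esymm (Fin n) ℂ k ∈ S := by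
          rw [hN]
          refine S.mul_mem (S.pow_mem (S.neg_mem S.one_mem) _) (S.sum_mem fun a ha => ?_)
          obtain ⟨ha, hak⟩ := Finset.mem_filter.1 ha
          rw [Finset.HasAntidiagonal.mem_antidiagonal] at ha
          refine S.mul_mem (S.mul_mem (S.pow_mem (S.neg_mem S.one_mem) _)
            (ih _ hak (hak.trans hk))) (Algebra.subset_adjoin (Or.inr ⟨a.2, ?_, ?_, rfl⟩)) <;> omega
        have hk' : (k : ℂ) ≠ 0 := Nat.cast_ne_zero.2 hk0.ne'
        have := S.smul_mem hmem (k : ℂ)⁻¹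
        rwa [← nsmul_eq_mul, ← Nat.cast_smul_eq_nsmul ℂ, smul_smul, inv_mul_cancel₀ hk',
          one_smul] at this
  obtain ⟨Q, hQ⟩ := MvPolynomial.esymmAlgHom_fin_surjective (n := n) (m := n) ℂ le_rfl ⟨P, hP⟩
  have hQ' := congrArg Subtype.val hQ
  rw [MvPolynomial.esymmAlgHom_apply] at hQ'
  have hmem : P ∈ (MvPolynomial.aeval (R := ℂ)
      fun i : Fin n => MvPolynomial.esymm (Fin n) ℂ (i + 1)).range := ⟨Q, hQ'⟩
  rw [MvPolynomial.aeval_range] at hmem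
  refine Algebra.adjoin_le ?_ hmem
  rintro _ ⟨i, rfl⟩
  rcases (Nat.succ_le_of_lt i.2).lt_or_eq with h | h
  · exact hlt _ h
  · exact Algebra.subset_adjoin (Or.inl (congrArg _ h))

end SMinusOne

/-! ### The action of monomial matrices -/

namespace MonomialGroup

open SMinusOne

variable {n : ℕ}

theorem coe_det (g : MonomialGroup n) :
    (det n g : ℂ) = (∏ i, (g.left i : ℂ)) * ((Equiv.Perm.sign g.right : ℤ) : ℂ) := by
  have h : toMatrix n g =
      Matrix.diagonal (fun i => (g.left i : ℂ)) * (g.right⁻¹).permMatrix ℂ := by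
    ext i j
    simp [toMatrix, Matrix.diagonal_mul, PEquiv.toMatrix_apply, Equiv.symm_apply_eq]
  change (toMatrix n g).det = _
  rw [h, Matrix.det_mul, Matrix.det_diagonal, Matrix.det_permutation, Equiv.Perm.sign_inv]

theorem det_inl (t : Fin n → ℂˣ) : det n (SemidirectProduct.inl t) = ∏ i, t i := by
  ext
  simp [coe_det]

theorem inl_smul_word (t : Fin n → ℂˣ) (L : List (Fin n)) :
    (SemidirectProduct.inl t : MonomialGroup n) • word L = (((L.map t).prod : ℂˣ) : ℂ) • word L := by
  induction L with
  | nil => simp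
  | cons i L ih =>
    rw [word_cons, smul_mul', ih, smul_def, act_x]
    simp [smul_smul, mul_comm]

/-- A permutation `w` acts on `x_1 ^ l ⋯ x_n ^ l` by `sign w ^ l`: an adjacent transposition
produces the sign `(-1) ^ (l * l)`. -/
theorem inr_smul_monomialR (l : ℕ) (w : Equiv.Perm (Fin n)) :
    (SemidirectProduct.inr w : MonomialGroup n) • monomialR n l =
      (((Equiv.Perm.sign w : ℤ) : ℂ) ^ l) • monomialR n l := by
  cases n with
  | zero =>
    rw [Subsingleton.elim w 1]
    simp
  | succ n =>
    have hw : w ∈ Submonoid.closure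
        (Set.range fun i : Fin n => Equiv.swap i.castSucc i.succ) := by
      rw [Equiv.Perm.mclosure_swap_castSucc_succ]; trivial
    induction hw using Submonoid.closure_induction with
    | mem w hw =>
      obtain ⟨i, rfl⟩ := hw
      have h := s_smul (n := n + 1) i (by omega) fun _ => l
      have hl : (-1 : ℂ) ^ (l * l) = (-1) ^ l := by
        rcases Nat.even_or_odd l with h | h
        · rw [(h.mul_right l).neg_one_pow, h.neg_one_pow]
        · rw [(h.mul h).neg_one_pow, h.neg_one_pow]
      rw [hl] at h
      simp only [Equiv.Perm.sign_swap i.castSucc_lt_succ.ne]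
      simpa only [Units.val_neg, Units.val_one, Int.cast_neg, Int.cast_one] using! h
    | one => simp
    | mul v w _ _ hv hw =>
      rw [map_mul, mul_smul, hw, smul_comm, hv, smul_smul, Equiv.Perm.sign_mul]
      simp [mul_pow, mul_comm]

theorem smul_monomialR (l : ℕ) (g : MonomialGroup n) :
    g • monomialR n l = ((det n g : ℂ) ^ l) • monomialR n l := by
  conv_lhs => rw [← SemidirectProduct.inl_left_mul_inr_right g, mul_smul, inr_smul_monomialR,
    smul_comm, monomialR, t_smul, Finset.prod_pow, smul_smul]
  rw [coe_det, mul_pow, mul_comm, monomialR]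

theorem smul_evalPow {m : ℕ} (hm : Even m) {g : MonomialGroup n} (hg : ∀ i, g.left i ^ m = 1)
    (P : MvPolynomial (Fin n) ℂ) :
    g • evalPow hm P = evalPow hm (MvPolynomial.rename g.right P) := by
  have h : (act g).comp (evalPow hm) = (evalPow hm).comp (MvPolynomial.rename g.right) := by
    ext i
    have := congrArg Units.val (hg (g.right i))
    rw [Units.val_pow_eq_pow_val, Units.val_one] at this
    simp [smul_pow, this]
  exact DFunLike.congr_fun h P

end MonomialGroup

open SMinusOne MonomialGroup

variable {n : ℕ}

/-! ### The group `W_{C,C'}` -/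

instance (C C' : Subgroup ℂˣ) [Finite C] : Finite (groupW n C C') :=
  Finite.of_injective
    (fun g => ((fun i => ⟨g.1.left i, g.2.1 i⟩, g.1.right) : (Fin n → C) × Equiv.Perm (Fin n)))
    fun g h hgh => by
      simp only [Prod.mk.injEq] at hgh
      exact Subtype.ext (SemidirectProduct.ext
        (funext fun i => congrArg Subtype.val (congrFun hgh.1 i)) hgh.2)

theorem pow_natCard_of_mem {G : Type*} [Group G] {H : Subgroup G} {u : G} (hu : u ∈ H) :
    u ^ Nat.card H = 1 :=
  congrArg Subtype.val (pow_card_eq_one' (x := (⟨u, hu⟩ : H)))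

theorem neg_one_mem_of_even_card {C : Subgroup ℂˣ} [Finite C] (hm : Even (Nat.card C)) :
    (-1 : ℂˣ) ∈ C := by
  obtain ⟨u, hu⟩ := exists_prime_orderOf_dvd_card' (G := C) 2 hm.two_dvd
  have h1 : (u : ℂˣ) ^ 2 = 1 := by
    rw [← Subgroup.coe_pow, ← hu, pow_orderOf_eq_one, Subgroup.coe_one]
  have h2 : (u : ℂˣ) ≠ 1 := by
    intro h
    rw [show u = 1 from Subtype.ext h, orderOf_one] at hu
    omega
  have h3 : ((u : ℂˣ) : ℂ) ^ 2 = 1 := by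
    rw [← Units.val_pow_eq_pow_val, h1, Units.val_one]
  rcases eq_or_eq_neg_of_sq_eq_sq (_ : ℂ) 1 (h3.trans (one_pow 2).symm) with h | h
  · exact absurd (Units.ext h) h2
  · have : (u : ℂˣ) = -1 := Units.ext (by simpa using h)
    exact this ▸ u.2

/-- Every permutation `w` is the permutation part of an element of `W_{C,C'}` of determinant one:
multiply the first row of the permutation matrix by `sign w`. -/
theorem exists_mem_groupW_right_eq (hn : 1 ≤ n) {C : Subgroup ℂˣ} (C' : Subgroup ℂˣ)
    (h1 : (-1 : ℂˣ) ∈ C) (w : Equiv.Perm (Fin n)) :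
    ∃ g ∈ groupW n C C', g.right = w := by
  let u : ℂˣ := Units.map (Int.castRingHom ℂ : ℤ →* ℂ) (Equiv.Perm.sign w)
  have hu : u = 1 ∨ u = -1 := by
    rcases Int.units_eq_one_or (Equiv.Perm.sign w) with h | h
    · left; ext; simp [u, h]
    · right; ext; simp [u, h]
  let t : Fin n → ℂˣ := Pi.mulSingle ⟨0, hn⟩ u
  refine ⟨⟨t, w⟩, ⟨fun i => ?_, ?_⟩, rfl⟩
  · change (Pi.mulSingle (⟨0, hn⟩ : Fin n) u : Fin n → ℂˣ) i ∈ C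
    rw [Pi.mulSingle_apply]
    split_ifs
    · rcases hu with h | h
      · rw [h]; exact C.one_mem
      · rwa [h]
    · exact C.one_mem
  · have : det n ⟨t, w⟩ = 1 := by
      ext
      have ht : ∏ i, (t i : ℂ) = u := by
        rw [← Units.coe_prod, Finset.prod_pi_mulSingle' , if_pos (Finset.mem_univ _)]
      rw [coe_det]
      change (∏ i, (t i : ℂ)) * _ = _
      rw [ht]
      change ((Equiv.Perm.sign w : ℤ) : ℂ) * ((Equiv.Perm.sign w : ℤ) : ℂ) = _
      rw [← Int.cast_mul, Int.units_coe_mul_self]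
      simp
    rw [this]
    exact C'.one_mem

/-! ### Torus weights -/

theorem prod_map_mulSingle (i : Fin n) (u : ℂˣ) (L : List (Fin n)) :
    (L.map (Pi.mulSingle i u : Fin n → ℂˣ)).prod = u ^ L.count i := by
  induction L with
  | nil => simp
  | cons j L ih =>
    rw [List.map_cons, List.prod_cons, ih, List.count_cons, Pi.mulSingle_apply]
    by_cases h : j = i <;> simp [h, pow_succ']

/-- If the torus part of `W_{C,C'}` fixes a word, then its exponents are congruent to each other
modulo `|C|` and divisible by `|C'|`. -/
theorem count_modEq_of_forall_torus {C C' : Subgroup ℂˣ} [Finite C] (hC : C' ≤ C)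
    {L : List (Fin n)}
    (h : ∀ t : Fin n → ℂˣ, SemidirectProduct.inl t ∈ groupW n C C' → (L.map t).prod = 1) :
    (∀ i j, L.count i ≡ L.count j [MOD Nat.card C]) ∧ ∀ i, Nat.card C' ∣ L.count i := by
  have : Finite C' := Finite.of_injective _ (Subgroup.inclusion_injective hC)
  constructor
  · intro i j
    rcases eq_or_ne i j with rfl | hij
    · rfl
    obtain ⟨ζ, hζ⟩ := IsCyclic.exists_ofOrder_eq_natCard (α := C)
    -- `ζ` in position `i` and `ζ⁻¹` in position `j`: an element of determinant one
    have ht := h (Pi.mulSingle i (ζ : ℂˣ) * Pi.mulSingle j (ζ : ℂˣ)⁻¹) ⟨fun a => ?_, ?_⟩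
    · have e : L.map (Pi.mulSingle i (ζ : ℂˣ) * Pi.mulSingle j (ζ : ℂˣ)⁻¹ : Fin n → ℂˣ) =
          L.map fun a => (Pi.mulSingle i (ζ : ℂˣ) : Fin n → ℂˣ) a *
            (Pi.mulSingle j (ζ : ℂˣ)⁻¹ : Fin n → ℂˣ) a := rfl
      rw [e, List.prod_map_mul, prod_map_mulSingle, prod_map_mulSingle, inv_pow,
        mul_inv_eq_one] at ht
      rw [← hζ, ← pow_eq_pow_iff_modEq]
      exact Subtype.ext (by simpa using ht)
    · refine C.mul_mem ?_ ?_
      · rw [Pi.mulSingle_apply]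
        split_ifs
        exacts [ζ.2, C.one_mem]
      · rw [Pi.mulSingle_apply]
        split_ifs
        exacts [C.inv_mem ζ.2, C.one_mem]
    · rw [det_inl]
      simp only [Pi.mul_apply, Finset.prod_mul_distrib, Finset.prod_pi_mulSingle',
        Finset.mem_univ, if_true, mul_inv_cancel]
      exact C'.one_mem
  · intro i
    obtain ⟨ζ, hζ⟩ := IsCyclic.exists_ofOrder_eq_natCard (α := C')
    have ht := h (Pi.mulSingle i (ζ : ℂˣ)) ⟨fun a => ?_, ?_⟩
    · rw [prod_map_mulSingle] at ht
      rw [← hζ, orderOf_dvd_iff_pow_eq_one]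
      exact Subtype.ext (by simpa using ht)
    · change (Pi.mulSingle i (ζ : ℂˣ) : Fin n → ℂˣ) a ∈ C
      rw [Pi.mulSingle_apply]
      split_ifs
      exacts [hC ζ.2, C.one_mem]
    · rw [det_inl, Finset.prod_pi_mulSingle', if_pos (Finset.mem_univ _)]
      exact ζ.2

/-! ### Averaging over the group -/

theorem smul_eq_self_of_mem_invariantGenerators {C C' : Subgroup ℂˣ} [Finite C] (hC : C' ≤ C)
    (hm : Even (Nat.card C)) {a : SMinusOne n}
    (ha : a ∈ invariantGenerators n (Nat.card C) (Nat.card C')) {g : MonomialGroup n}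
    (hg : g ∈ groupW n C C') : g • a = a := by
  have : Finite C' := Finite.of_injective _ (Subgroup.inclusion_injective hC)
  rcases ha with ⟨k, -, -, rfl⟩ | rfl
  · rw [← evalPow_psum hm, smul_evalPow hm fun i => pow_natCard_of_mem (hg.1 i),
      MvPolynomial.rename_psum]
  · rw [smul_monomialR, ← Units.val_pow_eq_pow_val, pow_natCard_of_mem hg.2, Units.val_one, one_smul]

theorem mul_comm_of_mem_invariantGenerators {m l : ℕ} (hm : Even m) {a b : SMinusOne n}
    (ha : a ∈ invariantGenerators n m l) (hb : b ∈ invariantGenerators n m l) :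
    a * b = b * a := by
  rcases ha with ⟨k, -, -, rfl⟩ | rfl
  · rw [← evalPow_psum hm]
    exact commute_evalPow hm _ b
  · rcases hb with ⟨k, -, -, rfl⟩ | rfl
    · rw [← evalPow_psum hm]
      exact (commute_evalPow hm _ _).symm
    · rfl

theorem monomialR_mem_adjoin (m l : ℕ) :
    monomialR n l ∈ Algebra.adjoin ℂ (invariantGenerators n m l) :=
  Algebra.subset_adjoin (s := invariantGenerators n m l) (Or.inr rfl)

/-- Symmetric polynomials in the `x_i ^ m` lie in the subalgebra generated by the power sums and
`r = x_1 ^ l ⋯ x_n ^ l`: the product of all the `x_i ^ m` is a scalar multiple of `r ^ (m / l)`. -/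
theorem evalPow_mem_adjoin_of_isSymmetric {m l : ℕ} (hm : Even m) (hl : l ∣ m)
    {P : MvPolynomial (Fin n) ℂ} (hP : P.IsSymmetric) :
    evalPow hm P ∈ Algebra.adjoin ℂ (invariantGenerators n m l) := by
  have h := Subalgebra.mem_map.2 ⟨P, hP.mem_adjoin_psum, (rfl : evalPow hm P = _)⟩
  rw [AlgHom.map_adjoin] at h
  refine Algebra.adjoin_le ?_ h
  rintro _ ⟨q, rfl | ⟨k, hk, hkn, rfl⟩, rfl⟩
  · obtain ⟨j, rfl⟩ := hl
    obtain ⟨ε, hε⟩ := exists_mono_const_mul_eq_smul (n := n) l j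
    -- the exponent `1` puts the product into the form of `evalPow_prod_X_pow`
    have he : MvPolynomial.esymm (Fin n) ℂ n =
        ((List.finRange n).map fun i => (MvPolynomial.X i : MvPolynomial (Fin n) ℂ) ^ 1).prod := by
      have h := Finset.powersetCard_self (Finset.univ : Finset (Fin n))
      rw [Finset.card_univ, Fintype.card_fin] at h
      rw [MvPolynomial.esymm, h, Finset.sum_singleton, ← List.ofFn_eq_map, List.prod_ofFn]
      simp
    rw [SetLike.mem_coe, he, evalPow_prod_X_pow hm fun _ => 1]
    simp only [mul_one]
    rw [hε]
    exact Subalgebra.smul_mem _ (Subalgebra.pow_mem _ (monomialR_mem_adjoin _ _) _) _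
  · rw [SetLike.mem_coe, evalPow_psum]
    exact Algebra.subset_adjoin (Or.inl ⟨k, hk, hkn, rfl⟩)

/-- A word whose exponents are congruent to each other modulo `m` and divisible by the divisor `l`
of `m` is, up to a scalar, a power of `x_1 ^ l ⋯ x_n ^ l` times a monomial in the `x_i ^ m`. -/
theorem exists_word_eq_smul_monomialR_pow_mul {m l : ℕ} (hn : 1 ≤ n) (hm : Even m) (hl : l ∣ m)
    {L : List (Fin n)} (h1 : ∀ i j, L.count i ≡ L.count j [MOD m]) (h2 : ∀ i, l ∣ L.count i) :
    ∃ (ε : ℂ) (j : ℕ) (P : MvPolynomial (Fin n) ℂ),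
      word L = ε • (monomialR n l ^ j * evalPow hm P) := by
  obtain ⟨j, hj⟩ : l ∣ L.count ⟨0, hn⟩ % m := (Nat.dvd_mod_iff hl).2 (h2 _)
  have hk : (fun i => L.count i) = (fun _ => l * j) + fun i => m * (L.count i / m) := by
    funext i
    rw [Pi.add_apply, ← hj, ← (h1 i ⟨0, hn⟩ : _ % m = _ % m), Nat.mod_add_div]
  obtain ⟨α, hα⟩ := exists_word_eq_smul_mono L
  obtain ⟨β, hβ⟩ := exists_mono_add_eq_smul (fun _ : Fin n => l * j) fun i => m * (L.count i / m)
  obtain ⟨γ, hγ⟩ := exists_mono_const_mul_eq_smul (n := n) l j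
  refine ⟨α * (β * γ), j,
    ((List.finRange n).map fun i => MvPolynomial.X i ^ (L.count i / m)).prod, ?_⟩
  rw [hα, hk, hβ, hγ, evalPow_prod_X_pow, smul_mul_assoc, smul_smul, smul_smul,
    mul_assoc]

/-- The sum of the translates of a word over `W_{C,C'}` is zero unless the torus part fixes the
word; in that case it is a scalar multiple of a power of `x_1 ^ l ⋯ x_n ^ l` times a symmetric
polynomial in the `x_i ^ m`, where `m = |C|` and `l = |C'|`. -/
theorem sum_smul_word_mem_adjoin (hn : 1 ≤ n) {C C' : Subgroup ℂˣ} [Finite C] (hC : C' ≤ C)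
    (hm : Even (Nat.card C)) [Fintype (groupW n C C')] (L : List (Fin n)) :
    ∑ g : groupW n C C', g • word L ∈
      Algebra.adjoin ℂ (invariantGenerators n (Nat.card C) (Nat.card C')) := by
  by_cases h : ∀ t : Fin n → ℂˣ, SemidirectProduct.inl t ∈ groupW n C C' → (L.map t).prod = 1
  · obtain ⟨h1, h2⟩ := count_modEq_of_forall_torus hC h
    have hl : Nat.card C' ∣ Nat.card C := Subgroup.card_dvd_of_le hC
    obtain ⟨ε, j, P, hP⟩ := exists_word_eq_smul_monomialR_pow_mul hn hm hl h1 h2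
    have hg : ∀ g : groupW n C C', g • word L = ε • (monomialR n (Nat.card C') ^ j *
        evalPow hm (MvPolynomial.rename g.1.right P)) := by
      intro g
      rw [Subgroup.smul_def, hP, smul_comm, smul_mul', smul_pow',
        smul_eq_self_of_mem_invariantGenerators hC hm (Or.inr rfl) g.2,
        smul_evalPow hm fun i => pow_natCard_of_mem (g.2.1 i)]
    simp_rw [hg]
    rw [← Finset.smul_sum, ← Finset.mul_sum, ← map_sum]
    refine Subalgebra.smul_mem _ (Subalgebra.mul_mem _ (Subalgebra.pow_mem _
      (monomialR_mem_adjoin _ _) _) (evalPow_mem_adjoin_of_isSymmetric hm hl ?_)) _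
    -- symmetry: reindex the sum by left translation with a lift of the permutation to the group
    intro w
    obtain ⟨g₀, hg₀, rfl⟩ := exists_mem_groupW_right_eq hn C' (neg_one_mem_of_even_card hm) w
    rw [map_sum]
    refine Fintype.sum_equiv (Equiv.mulLeft ⟨g₀, hg₀⟩) _ _ fun g => ?_
    rw [MvPolynomial.rename_rename]
    rfl
  · push Not at h
    obtain ⟨t, ht, ht1⟩ := h
    have hS : ∑ g : groupW n C C', g • word L =
        (((L.map t).prod : ℂˣ) : ℂ) • ∑ g : groupW n C C', g • word L := by
      rw [Finset.smul_sum, ← Equiv.sum_comp (Equiv.mulRight (⟨_, ht⟩ : groupW n C C'))]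
      refine Finset.sum_congr rfl fun g _ => ?_
      rw [Equiv.coe_mulRight, mul_smul, Subgroup.smul_def ⟨_, ht⟩, inl_smul_word, smul_comm]
    have h0 : ((((L.map t).prod : ℂˣ) : ℂ) - 1) • ∑ g : groupW n C C', g • word L = 0 := by
      rw [sub_smul, one_smul, ← hS, sub_self]
    rcases smul_eq_zero.1 h0 with h | h
    · exact absurd (Units.ext (sub_eq_zero.1 h)) ht1
    · rw [h]
      exact Subalgebra.zero_mem _

theorem sum_smul_mem_adjoin (hn : 1 ≤ n) {C C' : Subgroup ℂˣ} [Finite C] (hC : C' ≤ C)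
    (hm : Even (Nat.card C)) [Fintype (groupW n C C')] (a : SMinusOne n) :
    ∑ g : groupW n C C', g • a ∈
      Algebra.adjoin ℂ (invariantGenerators n (Nat.card C) (Nat.card C')) := by
  have ha : a ∈ Submodule.span ℂ (Set.range (word (n := n))) := by
    rw [span_range_word]; trivial
  induction ha using Submodule.span_induction with
  | mem a ha =>
    obtain ⟨L, rfl⟩ := ha
    exact sum_smul_word_mem_adjoin hn hC hm L
  | zero => simp
  | add a b _ _ ha hb =>
    simp_rw [smul_add, Finset.sum_add_distrib]
    exact Subalgebra.add_mem _ ha hb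
  | smul c a _ ha =>
    have h : ∑ g : groupW n C C', g • c • a = c • ∑ g : groupW n C C', g • a := by
      rw [Finset.smul_sum]
      exact Finset.sum_congr rfl fun g _ => smul_comm _ _ _
    rw [h]
    exact Subalgebra.smul_mem _ ha c

theorem mainTheorem3 (n : ℕ) (hn : 1 ≤ n) (C C' : Subgroup ℂˣ) [Finite C] (hC : C' ≤ C)
    (hm : Even (Nat.card C)) :
    (∀ a ∈ invariantGenerators n (Nat.card C) (Nat.card C'),
      ∀ b ∈ invariantGenerators n (Nat.card C) (Nat.card C'), a * b = b * a) ∧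
    (∀ a ∈ invariantGenerators n (Nat.card C) (Nat.card C'),
      ∀ g ∈ groupW n C C', g • a = a) ∧
    FixedPoints.subalgebra ℂ (SMinusOne n) (groupW n C C') =
      Algebra.adjoin ℂ (invariantGenerators n (Nat.card C) (Nat.card C')) := by
  refine ⟨fun a ha b hb => mul_comm_of_mem_invariantGenerators hm ha hb,
    fun a ha g hg => smul_eq_self_of_mem_invariantGenerators hC hm ha hg, le_antisymm ?_ ?_⟩
  · intro a ha
    have := Fintype.ofFinite (groupW n C C')
    have hsum : ∑ g : groupW n C C', g • a = (Fintype.card (groupW n C C') : ℂ) • a := by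
      rw [Finset.sum_congr rfl fun g _ => ha g, Finset.sum_const, Finset.card_univ,
        Nat.cast_smul_eq_nsmul]
    have hcard : (Fintype.card (groupW n C C') : ℂ) ≠ 0 := Nat.cast_ne_zero.2 Fintype.card_ne_zero
    have h := Subalgebra.smul_mem _ (sum_smul_mem_adjoin hn hC hm a)
      (Fintype.card (groupW n C C') : ℂ)⁻¹
    rwa [hsum, smul_smul, inv_mul_cancel₀ hcard, one_smul] at h
  · exact Algebra.adjoin_le fun a ha g => smul_eq_self_of_mem_invariantGenerators hC hm ha g.2
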